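/- For $\alpha\ge 0$ put $I=[-1,1]$, $\omega_\alpha(y)=(1-y^2)^\alpha$ and, for $c>0$, define on the complex Hilbert space $L^2(I,\omega_\alpha(y)\,dy)$ the integral operators $$\mathcal F_c^{\alpha}f(x)=\int_{-1}^1 e^{icxy}f(y)\,\omega_\alpha(y)\,dy,\qquad \mathcal Q_c^{\alpha}g(x)=\int_{-1}^1\frac{c}{2\pi}\,\mathcal K_\alpha(c(x-y))\,g(y)\,\omega_\alpha(y)\,dy,$$ $$\mathcal K_\alpha(x)=\sqrt{\pi}\,2^{\alpha+1/2}\,\Gamma(\alpha+1)\,\frac{J_{\alpha+1/2}(x)}{x^{\alpha+1/2}},$$ where $J_\nu$ is the Bessel function of the first kind and $J_\nu(x)/x^\nu$ denotes the corresponding even entire function of $x\in\mathbb R$. Let $\lambda_0^{(\alpha)}(c)\ge\lambda_1^{(\alpha)}(c)\ge\cdots$ be the eigenvalues of $\mathcal Q_c^\alpha$, listed in non-increasing order and repeated according to multiplicity. Let $c>0$. For every $\alpha\ge0$ there are an orthonormal basis $(\psi_n)_{n\ge0}$ of $L^2(I,\omega_\alpha(y)\,dy)$ and complex numbers $\mu_n=\mu_n^{(\alpha)}(c)$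 such that, for all $n\ge 0$, $\mathcal F_c^\alpha\psi_n=\mu_n\psi_n$, $\mathcal Q_c^\alpha\psi_n=\lambda_n^{(\alpha)}(c)\,\psi_n$ and $\lambda_n^{(\alpha)}(c)=\frac{c}{2\pi}|\mu_n^{(\alpha)}(c)|^2$. Moreover, for every integer $n\ge0$, $$\lambda_n^{(\alpha)}(c)\le\lambda_n^{(\alpha')}(c)\qquad\text{for all }\alpha\ge\alpha'\ge0 .$$ -/

import Mathlib

open MeasureTheory Set

noncomputable section

namespace GPSWF

/-- The weight `ω_α(y) = (1 - y²)^α`. -/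
def weight (α y : ℝ) : ℝ := (1 - y ^ 2) ^ α

/-- The measure `ω_α(y) dy` on `I = [-1, 1]` (extended by zero to `ℝ`). -/
def weightMeasure (α : ℝ) : Measure ℝ :=
  (volume.restrict (Icc (-1) 1)).withDensity fun y => ENNReal.ofReal (weight α y)

/-- The complex Hilbert space `L²(I, ω_α)`. -/
abbrev WeightedL2 (α : ℝ) : Type := Lp ℂ 2 (weightMeasure α)

/-- The finite weighted Fourier transform
`(F_c^α f)(x) = ∫_{-1}^1 e^{icxy} f(y) ω_α(y) dy`. -/
def fourierOp (α c : ℝ) (f : ℝ → ℂ) (x : ℝ) : ℂ :=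
  ∫ y, Complex.exp (Complex.I * ((c * x * y : ℝ) : ℂ)) * f y ∂(weightMeasure α)

/-- The Bessel function of the first kind `J_ν(x)`, for `x > 0`. -/
def besselJ (ν x : ℝ) : ℝ :=
  ∑' k : ℕ, (-1) ^ k / ((k.factorial : ℝ) * Real.Gamma (k + ν + 1)) *
    (x / 2) ^ (2 * (k : ℝ) + ν)

/-- The even entire function `J_ν(x) / x^ν` on the whole real line, including `x ≤ 0`. -/
def besselRatio (ν x : ℝ) : ℝ :=
  ∑' k : ℕ, (-1) ^ k / ((k.factorial : ℝ) * Real.Gamma (k + ν + 1)) *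
    ((2 : ℝ) ^ (-(2 * (k : ℝ) + ν)) * x ^ (2 * k))

theorem besselRatio_eq (ν : ℝ) {x : ℝ} (hx : 0 < x) :
    besselRatio ν x = besselJ ν x / x ^ ν := by
  unfold besselRatio besselJ
  rw [← tsum_div_const]
  refine tsum_congr fun k => ?_
  have h1 : x ^ (2 * (k : ℝ) + ν) = x ^ (2 * k) * x ^ ν := by
    rw [Real.rpow_add hx, ← Real.rpow_natCast]
    push_cast
    rfl
  have h2 : x ^ ν ≠ 0 := (Real.rpow_pos_of_pos hx ν).ne'
  rw [Real.div_rpow hx.le (by norm_num), h1, Real.rpow_neg (by norm_num)]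
  field_simp

/-- The kernel `K_α(x) = √π 2^{α+1/2} Γ(α+1) J_{α+1/2}(x) / x^{α+1/2}`. -/
def kernel (α x : ℝ) : ℝ :=
  Real.sqrt Real.pi * 2 ^ (α + 1 / 2) * Real.Gamma (α + 1) * besselRatio (α + 1 / 2) x

/-- The integral operator
`(Q_c^α g)(x) = ∫_{-1}^1 (c / 2π) K_α(c (x - y)) g(y) ω_α(y) dy`. -/
def kernelOp (α c : ℝ) (g : ℝ → ℂ) (x : ℝ) : ℂ :=
  ∫ y, ((c / (2 * Real.pi) * kernel α (c * (x - y)) : ℝ) : ℂ) * g y ∂(weightMeasure α)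

/-- `T g = s g` in `L²(I, ω_α)`; the zero vector is allowed. -/
def EigenEq {α : ℝ} (T : (ℝ → ℂ) → ℝ → ℂ) (s : ℂ) (g : WeightedL2 α) : Prop :=
  ∀ᵐ x ∂(weightMeasure α), T g x = s * g x

/-- `λ_n^{(α)}(c)`: the `n`-th eigenvalue, `n = 0, 1, 2, …`, of `Q_c^α` on `L²(I, ω_α)`, where
eigenvalues are listed in non-increasing order and repeated according to multiplicity, i.e. the
largest `t` for which there are `n + 1` linearly independent eigenfunctions with eigenvalues
at least `t`. -/
def lam (α c : ℝ) (n : ℕ) : ℝ :=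
  sSup {t : ℝ | ∃ v : Fin (n + 1) → WeightedL2 α, LinearIndependent ℂ v ∧
    ∀ i, ∃ s : ℝ, t ≤ s ∧ EigenEq (kernelOp α c) (s : ℂ) (v i)}

end GPSWF

end

/-!
For fixed `c`, the finite weighted Fourier transform `F` on `L²(ω_α)` has kernel
`exp (i c x y) = ∑ (i c)^k / k! * (x y)^k`, so it is a norm-convergent series of rank-one operators
built on the monomials. Taking real and imaginary parts of the coefficients gives `F = A + i B` with
`A` (kernel `cos (c x y)`, `cosOp`) and `B` (kernel `sin (c x y)`, `sinOp`) compact and symmetric.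
The weight is even, so its odd moments vanish and `A B = B A = 0`. By Fubini and Poisson's integral
for the Bessel function (`integral_exp_weightMeasure`), the operator with kernel
`c / 2π * K_α (c (x - y))` is `c / 2π * (A + i B) (A - i B) = c / 2π * (A² + B²)`.

Hence a joint orthonormal eigenbasis of `A` and `B` diagonalizes both operators, with
`μ = a + i b` and `λ = c / 2π * (a² + b²)`. It exists by the spectral theorem
(`exists_joint_hilbertBasis`) because `A` and `B` have trivial common kernel: `F g` is a power
series whose coefficients are multiples of the moments of `g`, and a function with vanishing
moments is zero (`eq_zero_of_cosOp_eq_zero_of_sinOp_eq_zero`). Since all eigenvalues are nonzero and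
accumulate only at zero, the basis can be listed with `λ` non-increasing
(`exists_antitone_joint_hilbertBasis`), and the counting definition of the `n`-th eigenvalue then
returns the `n`-th entry of that list (`setOf_linearIndependent_eigenvectors_eq_Iic`).

Monotonicity in `α` is a min-max argument. For `0 ≤ β ≤ α`, multiplication by `ω_{α-β}` is a
contraction `J : L²(ω_α) → L²(ω_β)`, the functions `F_α f` and `F_β (J f)` coincide, and the norm of
`L²(ω_α)` is dominated by that of `L²(ω_β)` since `ω_α ≤ ω_β`. So `‖F_α f‖ ≤ ‖F_β (J f)‖`. Some
nonzero `f` in the span of the first `n + 1` eigenfunctions of `F_α` has `J f` orthogonal to the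
first `n` eigenfunctions of `F_β`, and for it
`|μ_n(α)| ‖f‖ ≤ ‖F_α f‖ ≤ ‖F_β (J f)‖ ≤ |μ_n(β)| ‖f‖` (`norm_eigenvalue_le_of_contraction`).
-/

noncomputable section

namespace GPSWF

open Filter Topology InnerProductSpace
open scoped InnerProductSpace

/-! ### Joint diagonalization of two compact symmetric operators -/

section JointDiagonalization

open Module.End

variable {H : Type*} [NormedAddCommGroup H] [InnerProductSpace ℂ H]

/-- The images of eigenvectors with `ε ≤ ‖z i‖` are `ε`-separated in a relatively compact set. -/
theorem finite_setOf_le_norm_eigenvalue {ι : Type*} {T : H →L[ℂ] H} (hT : IsCompactOperator T)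
    {b : ι → H} (hb : Orthonormal ℂ b) {z : ι → ℂ} (hz : ∀ i, T (b i) = z i • b i)
    {ε : ℝ} (hε : 0 < ε) : {i | ε ≤ ‖z i‖}.Finite := by
  by_contra hinf
  have hinf : {i | ε ≤ ‖z i‖}.Infinite := hinf
  set e := hinf.natEmbedding
  obtain ⟨K, hK, hKs⟩ := hT.image_closedBall_subset_compact (f := (T : H →ₗ[ℂ] H)) 1
  have hmem : ∀ n, T (b (e n)) ∈ K := fun n =>
    hKs ⟨b (e n), by simp [hb.1], rfl⟩
  obtain ⟨x, -, φ, hφ, hlim⟩ := hK.tendsto_subseq hmem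
  obtain ⟨N, hN⟩ := Metric.cauchySeq_iff.1 hlim.cauchySeq ε hε
  have h1 := hN N le_rfl (N + 1) (by omega)
  have hne : (e (φ N) : ι) ≠ e (φ (N + 1)) := fun h =>
    (hφ (Nat.lt_succ_self N)).ne (e.injective (Subtype.ext h))
  have h2 : ‖T (b (e (φ N))) - T (b (e (φ (N + 1))))‖ ^ 2
      = ‖z (e (φ N))‖ ^ 2 + ‖z (e (φ (N + 1)))‖ ^ 2 := by
    have : ⟪T (b (e (φ N))), T (b (e (φ (N + 1))))⟫_ℂ = 0 := by
      rw [hz, hz, inner_smul_left, inner_smul_right, hb.2 hne]; simp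
    rw [norm_sub_sq (𝕜 := ℂ), this, hz, hz, norm_smul, norm_smul, hb.1, hb.1]
    simp
  rw [Function.comp, Function.comp, dist_eq_norm] at h1
  have h3 : ε ≤ ‖z (e (φ N))‖ := (e (φ N)).2
  nlinarith [norm_nonneg (T (b (e (φ N))) - T (b (e (φ (N + 1))))),
    sq_nonneg ‖z (e (φ (N + 1)))‖]

variable [CompleteSpace H]

/-- Two compact symmetric operators with `A B = 0` and trivial common kernel have a joint
orthonormal eigenbasis: for nonzero eigenvalues, an eigenspace of one operator lies in the
kernel of the other, so the joint eigenspaces other than the common kernel are finite-dimensional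
and together they contain all eigenvectors of `A` and of `B`. -/
theorem exists_joint_hilbertBasis {A B : H →L[ℂ] H} (hA : IsCompactOperator A)
    (hB : IsCompactOperator B) (hAs : A.IsSymmetric) (hBs : B.IsSymmetric)
    (hAB : ∀ x, A (B x) = 0) (hker : ∀ x, A x = 0 → B x = 0 → x = 0) :
    ∃ (ι : Type) (v : HilbertBasis ι ℂ H) (a b : ι → ℝ),
      (∀ i, A (v i) = (a i : ℂ) • v i) ∧ (∀ i, B (v i) = (b i : ℂ) • v i) := by
  -- `B A` is the adjoint of `A B`.
  have hBA : ∀ x, B (A x) = 0 := fun x => by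
    refine ext_inner_left ℂ fun y => ?_
    have h1 := hBs y (A x)
    have h2 := hAs (B y) x
    simp only [ContinuousLinearMap.coe_coe] at h1 h2
    rw [← h1, ← h2, hAB]; simp
  let V : ℂ × ℂ → Submodule ℂ H := fun p =>
    eigenspace (A : H →ₗ[ℂ] H) p.2 ⊓ eigenspace (B : H →ₗ[ℂ] H) p.1
  have hV : OrthogonalFamily ℂ (fun p => V p) fun p => (V p).subtypeₗᵢ :=
    LinearMap.IsSymmetric.orthogonalFamily_eigenspace_inf_eigenspace hAs hBs
  have memV : ∀ p x, x ∈ V p ↔ A x = p.2 • x ∧ B x = p.1 • x := fun p x => by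
    simp [V, Submodule.mem_inf]
  have hfin : ∀ p, FiniteDimensional ℂ (V p) := fun p => by
    by_cases h2 : p.2 = 0
    · by_cases h1 : p.1 = 0
      · have : V p = ⊥ := by
          rw [eq_bot_iff]
          intro x hx
          rw [memV, h1, h2] at hx
          simpa using hker x (by simpa using hx.1) (by simpa using hx.2)
        rw [this]; infer_instance
      · have := ContinuousLinearMap.finite_dimensional_eigenspace hB p.1 h1
        exact Submodule.finiteDimensional_inf_right _ _
    · have := ContinuousLinearMap.finite_dimensional_eigenspace hA p.2 h2
      exact Submodule.finiteDimensional_inf_left _ _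
  let w : ∀ p, OrthonormalBasis (Fin (Module.finrank ℂ (V p))) ℂ (V p) :=
    fun p => stdOrthonormalBasis ℂ (V p)
  let u : (Σ p : ℂ × ℂ, Fin (Module.finrank ℂ (V p))) → H := fun i => (w i.1 i.2 : H)
  have hu : Orthonormal ℂ u :=
    hV.orthonormal_sigma_orthonormal (v_family := fun p => w p) fun p => (w p).orthonormal
  have hdense : (Submodule.span ℂ (Set.range u))ᗮ = ⊥ := by
    rw [eq_bot_iff]
    intro x hx
    have hx' : ∀ p, ∀ y ∈ V p, ⟪y, x⟫_ℂ = 0 := fun p y hy => by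
      have hsum := congrArg (fun t : V p => (t : H)) ((w p).sum_repr ⟨y, hy⟩)
      simp only [Submodule.coe_sum, Submodule.coe_smul] at hsum
      rw [← hsum, sum_inner]
      refine Finset.sum_eq_zero fun j _ => ?_
      rw [inner_smul_left, (Submodule.mem_orthogonal _ _).1 hx _
        (Submodule.subset_span ⟨⟨p, j⟩, rfl⟩), mul_zero]
    -- A compact symmetric operator kills whatever is orthogonal to its eigenvectors of nonzero
    -- eigenvalue.
    have key : ∀ {C : H →L[ℂ] H}, IsCompactOperator C → C.IsSymmetric →
        (∀ (a : ℂ) (y : H), a ≠ 0 → C y = a • y → ⟪y, x⟫_ℂ = 0) → C x = 0 := by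
      intro C hC hCs h
      have hmem : C x ∈ (⨆ μ, eigenspace (C : H →ₗ[ℂ] H) μ)ᗮ := by
        rw [← Submodule.iInf_orthogonal, Submodule.mem_iInf]
        intro a
        rw [Submodule.mem_orthogonal]
        intro y hy
        have hy' : C y = a • y := by simpa [mem_eigenspace_iff] using hy
        have h1 := hCs y x
        simp only [ContinuousLinearMap.coe_coe] at h1
        rw [← h1, hy', inner_smul_left]
        by_cases ha : a = 0
        · simp [ha]
        · rw [h a y ha hy', mul_zero]
      rw [ContinuousLinearMap.orthogonalComplement_iSup_eigenspaces_eq_bot hC hCs] at hmem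
      simpa using hmem
    have hzero : ∀ {C D : H →L[ℂ] H}, (∀ y, D (C y) = 0) → ∀ (a : ℂ) (y : H), a ≠ 0 →
        C y = a • y → D y = 0 := by
      intro C D h a y ha hy
      have := h y
      rw [hy, map_smul] at this
      exact (smul_eq_zero.1 this).resolve_left ha
    simp only [Submodule.mem_bot]
    refine hker x (key hA hAs fun a y ha hy => ?_) (key hB hBs fun a y ha hy => ?_)
    · exact hx' (0, a) y ((memV _ _).2 ⟨hy, by simpa using hzero hBA a y ha hy⟩)
    · exact hx' (a, 0) y ((memV _ _).2 ⟨by simpa using hzero hAB a y ha hy, hy⟩)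
  have hreal : ∀ {C : H →L[ℂ] H} {a : ℂ} {y : H}, C.IsSymmetric → ‖y‖ = 1 → C y = a • y →
      C y = (a.re : ℂ) • y := by
    intro C a y hC hy h
    have h1 := hC.conj_eigenvalue_eq_self (μ := a) (hasEigenvalue_of_hasEigenvector (x := y)
      ⟨by simpa [mem_eigenspace_iff] using h, by rintro rfl; simp at hy⟩)
    rw [h, Complex.conj_eq_iff_re.1 h1]
  refine ⟨_, HilbertBasis.mkOfOrthogonalEqBot hu hdense, fun i => i.1.2.re, fun i => i.1.1.re,
    fun i => ?_, fun i => ?_⟩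
  · rw [HilbertBasis.coe_mkOfOrthogonalEqBot]
    exact hreal hAs (hu.1 i) ((memV _ _).1 (w i.1 i.2).2).1
  · rw [HilbertBasis.coe_mkOfOrthogonalEqBot]
    exact hreal hBs (hu.1 i) ((memV _ _).1 (w i.1 i.2).2).2

/-- A positive function on an infinite type with finite superlevel sets can be listed in
non-increasing order. -/
theorem exists_equiv_antitone {ι : Type*} [Infinite ι] (f : ι → ℝ) (hpos : ∀ i, 0 < f i)
    (hf : ∀ ε > 0, {i | ε ≤ f i}.Finite) : ∃ e : ℕ ≃ ι, Antitone (f ∘ e) := by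
  classical
  have : Countable ι := by
    rw [← Set.countable_univ_iff]
    refine (Set.countable_iUnion fun n : ℕ => (hf (1 / (n + 1)) (by positivity)).countable).mono ?_
    intro i _
    obtain ⟨n, hn⟩ := exists_nat_one_div_lt (hpos i)
    exact mem_iUnion.2 ⟨n, hn.le⟩
  obtain ⟨enc, henc⟩ := exists_injective_nat ι
  -- Ordering by decreasing value, with ties broken by an enumeration, has order type `ω`.
  let g : ι → ℝᵒᵈ ×ₗ ℕ := fun i => toLex (OrderDual.toDual (f i), enc i)
  have hg : Function.Injective g := fun i j h => henc (congrArg (fun p => (ofLex p).2) h)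
  let _ : LinearOrder ι := LinearOrder.lift' g hg
  have hle : ∀ {i j : ι}, i ≤ j → f j ≤ f i := by
    intro i j h
    rcases Prod.Lex.le_iff.1 (show g i ≤ g j from h) with h | h
    · exact le_of_lt h
    · exact le_of_eq (congrArg OrderDual.ofDual h.1).symm
  have hfin : ∀ i : ι, (Iic i).Finite := fun i => (hf (f i) (hpos i)).subset fun j hj => hle hj
  let _ : LocallyFiniteOrder ι := LocallyFiniteOrder.ofFiniteIcc fun a b =>
    (hfin b).subset Icc_subset_Iic_self
  obtain ⟨i₀⟩ : Nonempty ι := inferInstance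
  obtain ⟨m, hm, hmin⟩ := Set.exists_min_image (Iic i₀) id (hfin i₀) ⟨i₀, le_refl i₀⟩
  let _ : OrderBot ι :=
    { bot := m
      bot_le := fun j => (le_total j i₀).elim (fun h => hmin j h) (fun h => le_trans hm h) }
  have : NoMaxOrder ι := ⟨fun i => by
    by_contra! h
    exact Set.infinite_univ ((hfin i).subset fun j _ => h j)⟩
  let _ : SuccOrder ι := LinearLocallyFiniteOrder.succOrder ι
  let _ : PredOrder ι := LinearLocallyFiniteOrder.predOrder ι
  let e : ι ≃o ℕ := orderIsoNatOfLinearSuccPredArch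
  exact ⟨e.symm.toEquiv, fun m n h => hle (e.symm.monotone h)⟩

/-- The spectral theorem in the sorted form used below: the joint eigenbasis of `A` and `B`,
listed with `a n ^ 2 + b n ^ 2` non-increasing. -/
theorem exists_antitone_joint_hilbertBasis (hinf : ¬ FiniteDimensional ℂ H)
    {A B : H →L[ℂ] H} (hA : IsCompactOperator A)
    (hB : IsCompactOperator B) (hAs : A.IsSymmetric) (hBs : B.IsSymmetric)
    (hAB : ∀ x, A (B x) = 0) (hker : ∀ x, A x = 0 → B x = 0 → x = 0) :
    ∃ (v : HilbertBasis ℕ ℂ H) (a b : ℕ → ℝ),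
      (∀ n, A (v n) = (a n : ℂ) • v n) ∧ (∀ n, B (v n) = (b n : ℂ) • v n) ∧
      Antitone fun n => a n ^ 2 + b n ^ 2 := by
  obtain ⟨ι, v, a, b, ha, hb⟩ := exists_joint_hilbertBasis hA hB hAs hBs hAB hker
  have hι : Infinite ι := by
    by_contra h
    have : Finite ι := not_infinite_iff_finite.1 h
    have := Fintype.ofFinite ι
    exact hinf (v.toOrthonormalBasis.toBasis.finiteDimensional_of_finite)
  have hpos : ∀ i, 0 < a i ^ 2 + b i ^ 2 := fun i => by
    rcases eq_or_ne (a i) 0 with h1 | h1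
    · rcases eq_or_ne (b i) 0 with h2 | h2
      · have h0 := hker (v i) (by rw [ha, h1]; simp) (by rw [hb, h2]; simp)
        have := v.orthonormal.1 i
        rw [h0] at this; simp at this
      · positivity
    · positivity
  have hfin : ∀ ε > 0, {i | ε ≤ a i ^ 2 + b i ^ 2}.Finite := fun ε hε => by
    have fa := finite_setOf_le_norm_eigenvalue hA v.orthonormal ha (Real.sqrt_pos.2 (half_pos hε))
    have fb := finite_setOf_le_norm_eigenvalue hB v.orthonormal hb (Real.sqrt_pos.2 (half_pos hε))
    refine (fa.union fb).subset fun i hi => ?_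
    simp only [mem_ofPred_eq, mem_union, Complex.norm_real, Real.norm_eq_abs] at hi ⊢
    by_contra! h
    have h1 := (Real.lt_sqrt (abs_nonneg _)).1 h.1
    have h2 := (Real.lt_sqrt (abs_nonneg _)).1 h.2
    rw [sq_abs] at h1 h2
    linarith
  obtain ⟨e, he⟩ := exists_equiv_antitone _ hpos hfin
  have hon : Orthonormal ℂ (v ∘ e) := v.orthonormal.comp e e.injective
  have hd : ⊤ ≤ (Submodule.span ℂ (Set.range (v ∘ e))).topologicalClosure := by
    rw [EquivLike.range_comp, v.dense_span]
  refine ⟨HilbertBasis.mk hon hd, a ∘ e, b ∘ e, fun n => ?_, fun n => ?_, he⟩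
  · simp [ha]
  · simp [hb]

end JointDiagonalization

/-! ### Eigenvalue counting and comparison of singular values -/

section EigenvalueComparison

variable {H : Type*} [NormedAddCommGroup H] [InnerProductSpace ℂ H]

/-- By counting dimensions, `n` orthogonality conditions have a nonzero solution among the
combinations of `n + 1` vectors. -/
theorem exists_ne_zero_forall_inner_eq_zero {n : ℕ} (v : Fin (n + 1) → H) (w : ℕ → H) :
    ∃ d : Fin (n + 1) → ℂ, d ≠ 0 ∧ ∀ k < n, ⟪w k, ∑ i, d i • v i⟫_ℂ = 0 := by
  let L : (Fin (n + 1) → ℂ) →ₗ[ℂ] (Fin n → ℂ) :=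
    LinearMap.pi fun k => (innerSL ℂ (w k) : H →ₗ[ℂ] ℂ) ∘ₗ
      Fintype.linearCombination ℂ v
  have hL : LinearMap.ker L ≠ ⊥ := LinearMap.ker_ne_bot_of_finrank_lt (by simp)
  obtain ⟨d, hd, hd0⟩ := Submodule.exists_mem_ne_zero_of_ne_bot hL
  refine ⟨d, hd0, fun k hk => ?_⟩
  have := congrFun (LinearMap.mem_ker.1 hd) ⟨k, hk⟩
  simpa only [L, LinearMap.pi_apply, LinearMap.comp_apply, Fintype.linearCombination_apply,
    ContinuousLinearMap.coe_coe, innerSL_apply_apply, Pi.zero_apply] using this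

/-- The counting definition of the `n`-th eigenvalue agrees with the `n`-th entry of a sorted
eigenvalue list of an orthonormal eigenbasis. -/
theorem setOf_linearIndependent_eigenvectors_eq_Iic (ψ : HilbertBasis ℕ ℂ H)
    {T : H →L[ℂ] H} (hT : T.IsSymmetric) {l : ℕ → ℝ} (hl : Antitone l)
    (hψ : ∀ n, T (ψ n) = (l n : ℂ) • ψ n) (n : ℕ) :
    {t : ℝ | ∃ v : Fin (n + 1) → H, LinearIndependent ℂ v ∧
      ∀ i, ∃ s : ℝ, t ≤ s ∧ T (v i) = (s : ℂ) • v i} = Iic (l n) := by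
  ext t
  simp only [mem_ofPred_eq, mem_Iic]
  constructor
  · rintro ⟨v, hv, h⟩
    by_contra! ht
    -- Eigenvectors with eigenvalue at least `t > l n` only involve `ψ 0, …, ψ (n - 1)`.
    have hcoef : ∀ i, ∀ k, n ≤ k → ⟪ψ k, v i⟫_ℂ = 0 := by
      intro i k hk
      obtain ⟨s, hs, hvi⟩ := h i
      have h1 := hT (ψ k) (v i)
      simp only [ContinuousLinearMap.coe_coe] at h1
      rw [hψ, hvi, inner_smul_left, inner_smul_right, Complex.conj_ofReal] at h1
      have h2 : ((l k : ℂ) - s) * ⟪ψ k, v i⟫_ℂ = 0 := by rw [sub_mul, h1, sub_self]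
      have h3 : l k < s := (hl hk).trans_lt (ht.trans_le hs)
      refine (mul_eq_zero.1 h2).resolve_left ?_
      rw [← Complex.ofReal_sub]
      exact Complex.ofReal_ne_zero.2 (sub_ne_zero.2 h3.ne)
    obtain ⟨d, hd0, hd⟩ := exists_ne_zero_forall_inner_eq_zero v ψ
    have hzero : ∑ i, d i • v i = 0 := by
      rw [← ψ.repr.map_eq_zero_iff]
      ext k
      rw [ψ.repr_apply_apply]
      rcases lt_or_ge k n with hk | hk
      · rw [hd k hk]; rfl
      · rw [inner_sum]
        simp [inner_smul_right, hcoef _ k hk]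
    exact hd0 (funext (Fintype.linearIndependent_iff.1 hv d hzero))
  · intro ht
    exact ⟨fun i => ψ i, ψ.orthonormal.linearIndependent.comp _ Fin.val_injective,
      fun i => ⟨l i, ht.trans (hl (Nat.lt_succ_iff.1 i.2)), hψ i⟩⟩

/-- **Parseval's identity**. -/
theorem hasSum_norm_sq_inner {ι : Type*} (ψ : HilbertBasis ι ℂ H) (x : H) :
    HasSum (fun k => ‖⟪ψ k, x⟫_ℂ‖ ^ 2) (‖x‖ ^ 2) := by
  have h := (Complex.hasSum_re (ψ.hasSum_inner_mul_inner x x))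
  rw [inner_self_eq_norm_sq_to_K] at h
  convert! h using 1
  · ext k
    rw [← inner_conj_symm x, Complex.conj_mul', ← Complex.ofReal_pow, Complex.ofReal_re]
  · norm_cast

/-- Comparison of singular values through a contraction `J`: on the span of the first `n + 1`
eigenvectors of `T` there is a nonzero `f` with `J f` orthogonal to the first `n` eigenvectors
of `T'`. -/
theorem norm_eigenvalue_le_of_contraction {H' : Type*} [NormedAddCommGroup H']
    [InnerProductSpace ℂ H'] {T : H →L[ℂ] H} {T' : H' →L[ℂ] H'}
    (ψ : HilbertBasis ℕ ℂ H) (ψ' : HilbertBasis ℕ ℂ H') {z z' : ℕ → ℂ}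
    (hψ : ∀ n, T (ψ n) = z n • ψ n) (hψ' : ∀ n, T' (ψ' n) = z' n • ψ' n)
    (hz : Antitone fun n => ‖z n‖) (hz' : Antitone fun n => ‖z' n‖)
    (J : H →ₗ[ℂ] H') (hJ : ∀ f, ‖J f‖ ≤ ‖f‖) (hTT' : ∀ f, ‖T f‖ ≤ ‖T' (J f)‖) (n : ℕ) :
    ‖z n‖ ≤ ‖z' n‖ := by
  obtain ⟨d, hd0, hd⟩ := exists_ne_zero_forall_inner_eq_zero (fun k : Fin (n + 1) => J (ψ k)) ψ'
  set f : H := ∑ i, d i • ψ (i : Fin (n + 1)) with hf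
  have hJf : ∑ i : Fin (n + 1), d i • J (ψ i) = J f := by simp [hf]
  rw [hJf] at hd
  have hon : Orthonormal ℂ fun i : Fin (n + 1) => ψ i := ψ.orthonormal.comp _ Fin.val_injective
  have hf0 : f ≠ 0 := fun h =>
    hd0 (funext (Fintype.linearIndependent_iff.1 hon.linearIndependent d h))
  have hnorm : ∀ e : Fin (n + 1) → ℂ, ‖∑ i, e i • ψ i‖ ^ 2 = ∑ i, ‖e i‖ ^ 2 := by
    intro e
    have h := hon.inner_sum e e Finset.univ
    rw [inner_self_eq_norm_sq_to_K] at h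
    have h' := congrArg Complex.re h
    simp only [Complex.conj_mul', ← Complex.ofReal_pow, ← Complex.ofReal_sum,
      Complex.ofReal_re] at h'
    simpa [← Complex.ofReal_pow] using h'
  have h1 : ‖z n‖ ^ 2 * ‖f‖ ^ 2 ≤ ‖T f‖ ^ 2 := by
    have : T f = ∑ i : Fin (n + 1), (d i * z i) • ψ i := by
      simp [hf, hψ, mul_smul]
    rw [this, hnorm, hnorm, Finset.mul_sum]
    refine Finset.sum_le_sum fun i _ => ?_
    rw [norm_mul, mul_pow, mul_comm]
    gcongr
    exact hz (Nat.lt_succ_iff.1 i.2)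
  have h2 : ‖T' (J f)‖ ^ 2 ≤ ‖z' n‖ ^ 2 * ‖J f‖ ^ 2 := by
    have hs : HasSum (fun k => (⟪ψ' k, J f⟫_ℂ * z' k) • ψ' k) (T' (J f)) := by
      simpa [hψ', mul_smul, ψ'.repr_apply_apply] using (ψ'.hasSum_repr (J f)).mapL T'
    have hc : ∀ k, ⟪ψ' k, T' (J f)⟫_ℂ = ⟪ψ' k, J f⟫_ℂ * z' k := by
      intro k
      have h := hs.mapL (innerSL ℂ (ψ' k))
      have h' := h.unique (hasSum_single k fun j hj => by
        simp [ψ'.orthonormal.2 hj.symm])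
      simpa [inner_smul_right, inner_self_eq_norm_sq_to_K, ψ'.orthonormal.1 k] using h'
    refine hasSum_le (fun k => ?_) (hasSum_norm_sq_inner ψ' (T' (J f)))
      ((hasSum_norm_sq_inner ψ' (J f)).mul_left (‖z' n‖ ^ 2))
    rw [hc]
    rcases lt_or_ge k n with hk | hk
    · simp [hd k hk]
    · rw [norm_mul, mul_pow, mul_comm]
      gcongr
      exact hz' hk
  have h3 : ‖z n‖ ^ 2 * ‖f‖ ^ 2 ≤ ‖z' n‖ ^ 2 * ‖f‖ ^ 2 :=
    calc _ ≤ ‖T f‖ ^ 2 := h1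
      _ ≤ ‖T' (J f)‖ ^ 2 := by gcongr; exact hTT' f
      _ ≤ ‖z' n‖ ^ 2 * ‖J f‖ ^ 2 := h2
      _ ≤ _ := by gcongr; exact hJ f
  have hf2 : 0 < ‖f‖ ^ 2 := pow_pos (norm_pos_iff.2 hf0) 2
  exact pow_le_pow_iff_left₀ (norm_nonneg _) (norm_nonneg _) two_ne_zero |>.1
    (le_of_mul_le_mul_right h3 hf2)

end EigenvalueComparison

/-! ### Operators with kernel a power series in `x y` -/

section PowerOperators

theorem integrable_coeFn {μ : Measure ℝ} [IsFiniteMeasure μ] (g : Lp ℂ 2 μ) : Integrable g μ :=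
  (Lp.memLp g).integrable one_le_two

variable {μ : Measure ℝ} [IsFiniteMeasure μ] [hμ : Fact (∀ᵐ y ∂μ, |y| ≤ 1)]

theorem norm_ofReal_pow_le_one {y : ℝ} (hy : |y| ≤ 1) (k : ℕ) : ‖(y : ℂ) ^ k‖ ≤ 1 := by
  rw [norm_pow, Complex.norm_real, Real.norm_eq_abs]
  exact pow_le_one₀ (abs_nonneg y) hy

theorem memLp_ofReal_pow (μ : Measure ℝ) [IsFiniteMeasure μ] [hμ : Fact (∀ᵐ y ∂μ, |y| ≤ 1)]
    (k : ℕ) : MemLp (fun y : ℝ => (y : ℂ) ^ k) 2 μ :=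
  MemLp.of_bound (by fun_prop) 1 (hμ.out.mono fun _ hy => norm_ofReal_pow_le_one hy k)

/-- The monomial `y ^ k` as an element of `L²(μ)`, for a finite measure `μ` carried by `[-1, 1]`. -/
def monomialLp (μ : Measure ℝ) [IsFiniteMeasure μ] [Fact (∀ᵐ y ∂μ, |y| ≤ 1)] (k : ℕ) :
    Lp ℂ 2 μ := (memLp_ofReal_pow μ k).toLp _

theorem coeFn_monomialLp (k : ℕ) : monomialLp μ k =ᵐ[μ] fun y : ℝ => (y : ℂ) ^ k :=
  MemLp.coeFn_toLp _

theorem inner_monomialLp (k : ℕ) (g : Lp ℂ 2 μ) :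
    ⟪monomialLp μ k, g⟫_ℂ = ∫ y, (y : ℂ) ^ k * g y ∂μ := by
  rw [L2.inner_def]
  refine integral_congr_ae ?_
  filter_upwards [coeFn_monomialLp (μ := μ) k] with y hy
  rw [hy, RCLike.inner_apply, map_pow, Complex.conj_ofReal, mul_comm]

theorem inner_monomialLp_monomialLp (k l : ℕ) :
    ⟪monomialLp μ k, monomialLp μ l⟫_ℂ = ((∫ y, y ^ (k + l) ∂μ : ℝ) : ℂ) := by
  rw [inner_monomialLp, ← integral_complex_ofReal]
  refine integral_congr_ae ?_
  filter_upwards [coeFn_monomialLp (μ := μ) l] with y hy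
  rw [hy]; push_cast; ring

theorem norm_monomialLp_le (k : ℕ) :
    ‖monomialLp μ k‖ ≤ (measureUnivNNReal μ : ℝ) ^ ((2 : ENNReal).toReal⁻¹) := by
  have h := Lp.norm_le_of_ae_bound (f := monomialLp μ k) (C := 1) zero_le_one (by
    filter_upwards [coeFn_monomialLp (μ := μ) k, hμ.out] with y hy hy1
    rw [hy]
    exact norm_ofReal_pow_le_one hy1 k)
  simpa using h

/-- The operator `g ↦ ∑ k, z k ⟨y ^ k, g⟩ y ^ k` on `L²(μ)`, i.e. the integral operator with
kernel `∑ k, z k (x y) ^ k`. -/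
def powerOp (μ : Measure ℝ) [IsFiniteMeasure μ] [Fact (∀ᵐ y ∂μ, |y| ≤ 1)] (z : ℕ → ℂ) :
    Lp ℂ 2 μ →L[ℂ] Lp ℂ 2 μ :=
  ∑' k, z k • rankOne ℂ (monomialLp μ k) (monomialLp μ k)

variable {z w : ℕ → ℂ}

theorem summable_powerOp (hz : Summable fun k => ‖z k‖) :
    Summable fun k => z k • rankOne ℂ (monomialLp μ k) (monomialLp μ k) := by
  set M : ℝ := (measureUnivNNReal μ : ℝ) ^ ((2 : ENNReal).toReal⁻¹)
  refine Summable.of_norm_bounded (hz.mul_right (M * M)) fun k => ?_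
  rw [norm_smul, norm_rankOne]
  gcongr <;> exact norm_monomialLp_le k

theorem isCompactOperator_powerOp (hz : Summable fun k => ‖z k‖) :
    IsCompactOperator (powerOp μ z) := by
  refine isCompactOperator_of_tendsto (summable_powerOp hz).hasSum
    (Eventually.of_forall fun s => ?_)
  change ∑ k ∈ s, z k • rankOne ℂ (monomialLp μ k) (monomialLp μ k) ∈
    compactOperator (RingHom.id ℂ) (Lp ℂ 2 μ) (Lp ℂ 2 μ)
  -- The partial sums have finite rank.
  refine Submodule.sum_mem _ fun k _ => Submodule.smul_mem _ _ ?_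
  change IsCompactOperator (rankOne ℂ (monomialLp μ k) (monomialLp μ k))
  rw [rankOne_def']
  have h : IsCompactOperator (innerSL ℂ (monomialLp μ k)) :=
    isCompactOperator_of_locallyCompactSpace_dom (innerSL ℂ (monomialLp μ k))
  exact h.continuous_comp (ContinuousLinearMap.toSpanSingleton ℂ (monomialLp μ k)).continuous

theorem isSymmetric_powerOp {z : ℕ → ℝ} :
    (powerOp μ fun k => (z k : ℂ)).IsSymmetric := by
  refine ContinuousLinearMap.isSelfAdjoint_iff_isSymmetric.1 ?_
  rw [IsSelfAdjoint, powerOp, tsum_star]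
  refine tsum_congr fun k => ?_
  rw [star_smul, ContinuousLinearMap.star_eq_adjoint, adjoint_rankOne]
  simp

/-- The product of two such operators vanishes if the monomials occurring in one are orthogonal to
those occurring in the other. -/
theorem powerOp_powerOp_eq_zero (hz : Summable fun k => ‖z k‖) (hw : Summable fun k => ‖w k‖)
    (h : ∀ k l, z k ≠ 0 → w l ≠ 0 → ∫ y, y ^ (k + l) ∂μ = 0) (g : Lp ℂ 2 μ) :
    powerOp μ z (powerOp μ w g) = 0 := by
  have key : powerOp μ z * powerOp μ w = 0 := by
    rw [powerOp, powerOp, ← (summable_powerOp hw).tsum_mul_left]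
    refine (tsum_congr fun l => ?_).trans tsum_zero
    rw [← (summable_powerOp hz).tsum_mul_right]
    refine (tsum_congr fun k => ?_).trans tsum_zero
    by_cases hk : z k = 0
    · simp [hk]
    by_cases hl : w l = 0
    · simp [hl]
    rw [smul_mul_smul_comm, ContinuousLinearMap.mul_def, rankOne_comp_rankOne,
      inner_monomialLp_monomialLp, h k l hk hl]
    simp
  exact congrArg (fun T => T g) key

theorem powerOp_add (hz : Summable fun k => ‖z k‖) (hw : Summable fun k => ‖w k‖) (s : ℂ)
    (g : Lp ℂ 2 μ) :
    powerOp μ (fun k => z k + s * w k) g = powerOp μ z g + s • powerOp μ w g := by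
  have : powerOp μ (fun k => z k + s * w k) = powerOp μ z + s • powerOp μ w := by
    rw [powerOp, powerOp, powerOp, ← (summable_powerOp hw).tsum_const_smul,
      ← (summable_powerOp hz).tsum_add ((summable_powerOp hw).const_smul s)]
    exact tsum_congr fun k => by rw [add_smul, mul_smul]
  rw [this]; rfl

/-- The sum defining `powerOp` may be evaluated pointwise: a subsequence of the partial sums
converges almost everywhere to the `L²` limit. -/
theorem coeFn_powerOp_eq (hz : Summable fun k => ‖z k‖) (g : Lp ℂ 2 μ) {F : ℝ → ℂ}
    (hF : ∀ x : ℝ, HasSum (fun k => z k * (x : ℂ) ^ k * ∫ y, (y : ℂ) ^ k * g y ∂μ) (F x)) :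
    powerOp μ z g =ᵐ[μ] F := by
  have h1 : HasSum (fun k => (z k * ⟪monomialLp μ k, g⟫_ℂ) • monomialLp μ k) (powerOp μ z g) := by
    have := (ContinuousLinearMap.apply ℂ (Lp ℂ 2 μ) g).hasSum (summable_powerOp hz).hasSum
    simpa only [ContinuousLinearMap.apply_apply, smul_apply, rankOne_apply,
      mul_smul, powerOp] using this
  obtain ⟨φ, hφ, hlim⟩ := (tendstoInMeasure_of_tendsto_Lp h1.tendsto_sum_nat).exists_seq_tendsto_ae
  have h2 : ∀ᵐ x ∂μ, ∀ N, (∑ k ∈ Finset.range N,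
      (z k * ⟪monomialLp μ k, g⟫_ℂ) • monomialLp μ k : Lp ℂ 2 μ) x
      = ∑ k ∈ Finset.range N, z k * (x : ℂ) ^ k * ∫ y, (y : ℂ) ^ k * g y ∂μ := by
    rw [ae_all_iff]
    intro N
    have h3 : ∀ᵐ x ∂μ, ∀ k, ((z k * ⟪monomialLp μ k, g⟫_ℂ) • monomialLp μ k : Lp ℂ 2 μ) x
        = z k * (x : ℂ) ^ k * ∫ y, (y : ℂ) ^ k * g y ∂μ := by
      rw [ae_all_iff]
      intro k
      filter_upwards [Lp.coeFn_smul (z k * ⟪monomialLp μ k, g⟫_ℂ) (monomialLp μ k),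
        coeFn_monomialLp (μ := μ) k] with x hx1 hx2
      rw [hx1, Pi.smul_apply, hx2, smul_eq_mul, inner_monomialLp]; ring
    filter_upwards [h3, Lp.coeFn_fun_finsetSum (Finset.range N)
      (fun k => (z k * ⟪monomialLp μ k, g⟫_ℂ) • monomialLp μ k)] with x hx hx2
    rw [hx2]
    exact Finset.sum_congr rfl fun k _ => hx k
  filter_upwards [hlim, h2] with x hx1 hx2
  refine tendsto_nhds_unique hx1 ?_
  simp only [hx2]
  exact (hF x).tendsto_sum_nat.comp hφ.tendsto_atTop

end PowerOperators

/-! ### The finite Fourier transform of a measure on `[-1, 1]` -/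

section Fourier


/-- The Taylor coefficients of `t ↦ exp (i c t)`. -/
def expCoeff (c : ℝ) (k : ℕ) : ℂ := (Complex.I * c) ^ k / (k.factorial : ℂ)

theorem summable_norm_expCoeff (c : ℝ) : Summable fun k => ‖expCoeff c k‖ := by
  simpa [expCoeff] using Real.summable_pow_div_factorial |c|

theorem hasSum_expCoeff (c t : ℝ) :
    HasSum (fun k => expCoeff c k * (t : ℂ) ^ k) (Complex.exp (Complex.I * ((c * t : ℝ) : ℂ))) := by
  have h := NormedSpace.expSeries_div_hasSum_exp (𝔸 := ℂ) (Complex.I * ((c * t : ℝ) : ℂ))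
  rw [← Complex.exp_eq_exp_ℂ] at h
  convert! h using 1
  ext k
  rw [expCoeff]; push_cast; ring

/-- The Fourier integral of `g` is a power series in `x`, with the moments of `g` in its
coefficients. -/
theorem hasSum_integral_exp {μ : Measure ℝ} [hμ : Fact (∀ᵐ y ∂μ, |y| ≤ 1)] (c x : ℝ)
    {g : ℝ → ℂ} (hg : Integrable g μ) :
    HasSum (fun k => expCoeff c k * (x : ℂ) ^ k * ∫ y, (y : ℂ) ^ k * g y ∂μ)
      (∫ y, Complex.exp (Complex.I * ((c * x * y : ℝ) : ℂ)) * g y ∂μ) := by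
  simp only [← integral_const_mul]
  have hsum : Summable fun k => ‖expCoeff c k‖ * |x| ^ k := by
    refine (Real.summable_pow_div_factorial (|c| * |x|)).congr fun k => ?_
    simp only [expCoeff, norm_div, norm_pow, norm_mul, Complex.norm_I, Complex.norm_real,
      Real.norm_eq_abs, Complex.norm_natCast]
    ring
  refine hasSum_integral_of_dominated_convergence (fun k y => ‖expCoeff c k‖ * |x| ^ k * ‖g y‖)
    (fun k => ?_) (fun k => ?_) (ae_of_all _ fun y => hsum.mul_right _) ?_ (ae_of_all _ fun y => ?_)
  · exact (AEStronglyMeasurable.mul (by fun_prop) hg.1).const_mul _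
  · filter_upwards [hμ.out] with y hy
    rw [norm_mul, norm_mul, norm_mul, norm_pow (x : ℂ), Complex.norm_real, Real.norm_eq_abs]
    gcongr
    exact mul_le_of_le_one_left (norm_nonneg _) (norm_ofReal_pow_le_one hy k)
  · simp only [tsum_mul_right]
    exact hg.norm.const_mul _
  · have h := (hasSum_expCoeff c (x * y)).mul_right (g y)
    convert! h using 1
    · ext k; push_cast; ring
    · rw [mul_assoc c]

variable {μ : Measure ℝ} [IsFiniteMeasure μ] [hμ : Fact (∀ᵐ y ∂μ, |y| ≤ 1)]

/-- The even part of the kernel: the integral operator with kernel `cos (c x y)`. -/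
def cosOp (μ : Measure ℝ) [IsFiniteMeasure μ] [Fact (∀ᵐ y ∂μ, |y| ≤ 1)] (c : ℝ) :
    Lp ℂ 2 μ →L[ℂ] Lp ℂ 2 μ := powerOp μ fun k => ((expCoeff c k).re : ℂ)

/-- The odd part of the kernel: the integral operator with kernel `sin (c x y)`. -/
def sinOp (μ : Measure ℝ) [IsFiniteMeasure μ] [Fact (∀ᵐ y ∂μ, |y| ≤ 1)] (c : ℝ) :
    Lp ℂ 2 μ →L[ℂ] Lp ℂ 2 μ := powerOp μ fun k => ((expCoeff c k).im : ℂ)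

theorem summable_norm_re_expCoeff (c : ℝ) : Summable fun k => ‖((expCoeff c k).re : ℂ)‖ :=
  (summable_norm_expCoeff c).of_nonneg_of_le (fun _ => norm_nonneg _) fun k => by
    simpa using Complex.abs_re_le_norm (expCoeff c k)

theorem summable_norm_im_expCoeff (c : ℝ) : Summable fun k => ‖((expCoeff c k).im : ℂ)‖ :=
  (summable_norm_expCoeff c).of_nonneg_of_le (fun _ => norm_nonneg _) fun k => by
    simpa using Complex.abs_im_le_norm (expCoeff c k)

theorem expCoeff_neg (c : ℝ) (k : ℕ) : expCoeff (-c) k = (starRingEnd ℂ) (expCoeff c k) := by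
  simp [expCoeff]

theorem expCoeff_im_of_even (c : ℝ) {k : ℕ} (hk : Even k) : (expCoeff c k).im = 0 := by
  rw [← Complex.conj_eq_iff_im, ← expCoeff_neg, expCoeff, expCoeff, Complex.ofReal_neg, mul_neg,
    hk.neg_pow]

theorem expCoeff_re_of_odd (c : ℝ) {k : ℕ} (hk : Odd k) : (expCoeff c k).re = 0 := by
  have h : (starRingEnd ℂ) (expCoeff c k) = -expCoeff c k := by
    rw [← expCoeff_neg, expCoeff, expCoeff, Complex.ofReal_neg, mul_neg, hk.neg_pow, neg_div]
  have := congrArg Complex.re h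
  simp only [Complex.conj_re, Complex.neg_re] at this
  linarith

/-- `cosOp + i sinOp` is the finite Fourier transform. -/
theorem coeFn_cosOp_add_sinOp (c : ℝ) (g : Lp ℂ 2 μ) :
    (cosOp μ c g + Complex.I • sinOp μ c g : Lp ℂ 2 μ) =ᵐ[μ]
      fun x : ℝ => ∫ y, Complex.exp (Complex.I * ((c * x * y : ℝ) : ℂ)) * g y ∂μ := by
  rw [cosOp, sinOp, ← powerOp_add (summable_norm_re_expCoeff c) (summable_norm_im_expCoeff c)]
  have h : (fun k => ((expCoeff c k).re : ℂ) + Complex.I * ((expCoeff c k).im : ℂ))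
      = expCoeff c := by
    ext k; rw [mul_comm, Complex.re_add_im]
  rw [h]
  exact coeFn_powerOp_eq (summable_norm_expCoeff c) g
    fun x : ℝ => hasSum_integral_exp c x (integrable_coeFn g)

theorem cosOp_neg (c : ℝ) : cosOp μ (-c) = cosOp μ c := by
  simp [cosOp, expCoeff_neg]

theorem sinOp_neg (c : ℝ) (g : Lp ℂ 2 μ) : sinOp μ (-c) g = - sinOp μ c g := by
  have := powerOp_add (μ := μ) (z := 0) (by simp)
    (summable_norm_im_expCoeff c) (-1) g
  simpa [sinOp, expCoeff_neg, powerOp] using this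

theorem even_of_re_expCoeff_ne_zero {c : ℝ} {k : ℕ} (h : ((expCoeff c k).re : ℂ) ≠ 0) :
    Even k := by
  by_contra hk
  exact h (by rw [expCoeff_re_of_odd c (Nat.not_even_iff_odd.1 hk), Complex.ofReal_zero])

theorem odd_of_im_expCoeff_ne_zero {c : ℝ} {k : ℕ} (h : ((expCoeff c k).im : ℂ) ≠ 0) :
    Odd k := by
  by_contra hk
  exact h (by rw [expCoeff_im_of_even c (Nat.not_odd_iff_even.1 hk), Complex.ofReal_zero])

theorem cosOp_sinOp (hodd : ∀ k, Odd k → ∫ y, y ^ k ∂μ = 0) (c : ℝ) (g : Lp ℂ 2 μ) :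
    cosOp μ c (sinOp μ c g) = 0 :=
  powerOp_powerOp_eq_zero (summable_norm_re_expCoeff c) (summable_norm_im_expCoeff c)
    (fun _ _ hk hl => hodd _
      ((even_of_re_expCoeff_ne_zero hk).add_odd (odd_of_im_expCoeff_ne_zero hl))) g

theorem sinOp_cosOp (hodd : ∀ k, Odd k → ∫ y, y ^ k ∂μ = 0) (c : ℝ) (g : Lp ℂ 2 μ) :
    sinOp μ c (cosOp μ c g) = 0 :=
  powerOp_powerOp_eq_zero (summable_norm_im_expCoeff c) (summable_norm_re_expCoeff c)
    (fun _ _ hk hl => hodd _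
      ((odd_of_im_expCoeff_ne_zero hk).add_even (even_of_re_expCoeff_ne_zero hl))) g

end Fourier

/-! ### Injectivity of the finite Fourier transform -/

section Density

/-- A function all of whose moments vanish is zero, since test functions are uniform limits of
polynomials on `[-1, 1]`. -/
theorem ae_eq_zero_of_integral_pow_mul_eq_zero {μ : Measure ℝ} [hμ : Fact (∀ᵐ y ∂μ, |y| ≤ 1)]
    {g : ℝ → ℂ} (hg : Integrable g μ) (h : ∀ k : ℕ, ∫ y, (y : ℂ) ^ k * g y ∂μ = 0) :
    g =ᵐ[μ] 0 := by
  have hint : ∀ k : ℕ, Integrable (fun y : ℝ => (y : ℂ) ^ k * g y) μ := fun k => by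
    refine hg.bdd_mul (c := 1) (by fun_prop) ?_
    exact hμ.out.mono fun y hy => norm_ofReal_pow_le_one hy k
  have hpolyeq : ∀ (p : Polynomial ℝ) (y : ℝ), ((p.eval y : ℝ) : ℂ) * g y
      = ∑ k ∈ Finset.range (p.natDegree + 1), (p.coeff k : ℂ) * ((y : ℂ) ^ k * g y) := by
    intro p y
    rw [Polynomial.eval_eq_sum_range, Complex.ofReal_sum, Finset.sum_mul]
    exact Finset.sum_congr rfl fun k _ => by push_cast; ring
  have hpint : ∀ p : Polynomial ℝ, Integrable (fun y => ((p.eval y : ℝ) : ℂ) * g y) μ := by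
    intro p
    simp only [hpolyeq]
    exact integrable_finsetSum _ fun k _ => (hint k).const_mul _
  have hpoly : ∀ p : Polynomial ℝ, ∫ y, ((p.eval y : ℝ) : ℂ) * g y ∂μ = 0 := by
    intro p
    simp only [hpolyeq]
    rw [integral_finsetSum _ fun k _ => (hint k).const_mul _]
    exact Finset.sum_eq_zero fun k _ => by rw [integral_const_mul, h, mul_zero]
  refine ae_eq_zero_of_integral_contDiff_smul_eq_zero hg.locallyIntegrable fun φ hφ hφc => ?_
  rw [← norm_le_zero_iff]
  refine le_of_forall_pos_le_add fun ε hε => ?_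
  set M := ∫ y, ‖g y‖ ∂μ
  have hM0 : 0 ≤ M := integral_nonneg fun _ => norm_nonneg _
  obtain ⟨p, hp⟩ := exists_polynomial_near_of_continuousOn (-1) 1 φ hφ.continuous.continuousOn
    (ε / (M + 1)) (by positivity)
  have hφint : Integrable (fun y => φ y • g y) μ := by
    obtain ⟨C, hC⟩ := hφc.exists_bound_of_continuous hφ.continuous
    exact hg.bdd_smul C hφ.continuous.aestronglyMeasurable (ae_of_all _ hC)
  have : ∫ y, φ y • g y ∂μ = ∫ y, (φ y • g y - ((p.eval y : ℝ) : ℂ) * g y) ∂μ := by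
    rw [integral_sub hφint (hpint p), hpoly, sub_zero]
  rw [this, zero_add]
  calc ‖∫ y, (φ y • g y - ((p.eval y : ℝ) : ℂ) * g y) ∂μ‖
      ≤ ∫ y, ε / (M + 1) * ‖g y‖ ∂μ := by
        refine norm_integral_le_of_norm_le (hg.norm.const_mul _) ?_
        filter_upwards [hμ.out] with y hy
        rw [Complex.real_smul, ← sub_mul, norm_mul, ← Complex.ofReal_sub, Complex.norm_real,
          Real.norm_eq_abs, abs_sub_comm]
        gcongr
        exact (hp y (abs_le.1 hy)).le
    _ = ε * (M / (M + 1)) := by rw [integral_const_mul]; ring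
    _ ≤ ε := mul_le_of_le_one_right hε.le (by rw [div_le_one (by positivity)]; linarith)

variable {μ : Measure ℝ} [IsFiniteMeasure μ] [hμ : Fact (∀ᵐ y ∂μ, |y| ≤ 1)]

/-- If sets of full measure accumulate at `0`, then the monomials are linearly independent in
`L²(μ)`, because a nonzero polynomial has finitely many roots. -/
theorem not_finiteDimensional_Lp
    (hfreq : ∀ p : ℝ → Prop, (∀ᵐ x ∂μ, p x) → ∃ᶠ x in 𝓝[≠] 0, p x) :
    ¬ FiniteDimensional ℂ (Lp ℂ 2 μ) := by
  intro hfin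
  have hli : LinearIndependent ℂ (monomialLp μ) := by
    rw [linearIndependent_iff']
    intro s d hd i hi
    let p : Polynomial ℂ := ∑ k ∈ s, Polynomial.monomial k (d k)
    have h1 : ∀ᵐ x : ℝ ∂μ, p.eval (x : ℂ) = 0 := by
      have h2 : ∀ᵐ x ∂μ, ∀ k, (d k • monomialLp μ k : Lp ℂ 2 μ) x = d k * (x : ℂ) ^ k := by
        rw [ae_all_iff]
        intro k
        filter_upwards [Lp.coeFn_smul (d k) (monomialLp μ k), coeFn_monomialLp (μ := μ) k]
          with x hx1 hx2
        rw [hx1, Pi.smul_apply, hx2, smul_eq_mul]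
      have h3 := Lp.coeFn_fun_finsetSum s (fun k => d k • monomialLp μ k)
      rw [hd] at h3
      filter_upwards [h2, h3, Lp.coeFn_zero ℂ 2 μ] with x hx2 hx3 hx0
      rw [hx0] at hx3
      simp only [hx2] at hx3
      simp only [p, Polynomial.eval_finsetSum, Polynomial.eval_monomial]
      exact hx3.symm
    have hp : p = 0 := by
      refine p.eq_zero_of_infinite_isRoot ?_
      have hinf : {x : ℝ | p.eval (x : ℂ) = 0}.Infinite := by
        intro hs
        have hnhds := (hs.subset sdiff_subset).isClosed.isOpen_compl.mem_nhds
          (show (0 : ℝ) ∉ {x : ℝ | p.eval (x : ℂ) = 0} \ {0} from fun h => h.2 rfl)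
        refine hfreq _ h1 (eventually_nhdsWithin_iff.2 (Filter.mem_of_superset hnhds ?_))
        exact fun x hx hx0 hpx => hx ⟨hpx, hx0⟩
      exact (hinf.image (Complex.ofReal_injective.injOn)).mono (by rintro _ ⟨x, hx, rfl⟩; exact hx)
    have := congrArg (fun q => q.coeff i) hp
    simpa [p, Polynomial.finsetSum_coeff, Polynomial.coeff_monomial, hi] using this
  exact not_finite_iff_infinite.2 inferInstance hli.finite

/-- The Fourier operator is injective: the Fourier integral is a power series in `x` whose
coefficients are multiples of the moments of `g`. -/
theorem eq_zero_of_cosOp_eq_zero_of_sinOp_eq_zero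
    (hfreq : ∀ p : ℝ → Prop, (∀ᵐ x ∂μ, p x) → ∃ᶠ x in 𝓝[≠] 0, p x) {c : ℝ} (hc : c ≠ 0)
    (g : Lp ℂ 2 μ) (h1 : cosOp μ c g = 0) (h2 : sinOp μ c g = 0) : g = 0 := by
  set F : ℝ → ℂ := fun x => ∫ y, Complex.exp (Complex.I * ((c * x * y : ℝ) : ℂ)) * g y ∂μ
  have hae : ∀ᵐ x ∂μ, F x = 0 := by
    have h := coeFn_cosOp_add_sinOp (μ := μ) c g
    rw [h1, h2, smul_zero, add_zero] at h
    filter_upwards [h, Lp.coeFn_zero ℂ 2 μ] with x hx hx0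
    exact hx.symm.trans hx0
  let m : ℕ → ℂ := fun k => expCoeff c k * ∫ y, (y : ℂ) ^ k * g y ∂μ
  let P : FormalMultilinearSeries ℝ ℝ ℂ := fun k =>
    ContinuousMultilinearMap.mkPiRing ℝ (Fin k) (m k)
  have hcoeff : ∀ k, P.coeff k = m k := fun k => by
    simp [P, FormalMultilinearSeries.coeff]
  have hP : HasFPowerSeriesAt F P 0 := by
    rw [hasFPowerSeriesAt_iff']
    refine Eventually.of_forall fun x => ?_
    convert! hasSum_integral_exp c x (integrable_coeFn g) using 1
    ext k
    rw [hcoeff, sub_zero, Complex.real_smul]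
    push_cast
    simp only [m]
    ring
  have hzero : F =ᶠ[𝓝 0] 0 :=
    (hP.analyticAt.frequently_zero_iff_eventually_zero).1 (hfreq _ hae)
  have hP0 : P = 0 := (hP.congr hzero).eq_zero
  refine Lp.eq_zero_iff_ae_eq_zero.2 (ae_eq_zero_of_integral_pow_mul_eq_zero
    (integrable_coeFn g) fun k => ?_)
  have hm : m k = 0 := by rw [← hcoeff, hP0]; simp [FormalMultilinearSeries.coeff]
  refine (mul_eq_zero.1 hm).resolve_left ?_
  simp [expCoeff, hc, Nat.factorial_ne_zero]

end Density

/-! ### The composition of the transform with its adjoint -/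

section Composition

variable {μ : Measure ℝ} [IsFiniteMeasure μ] [hμ : Fact (∀ᵐ y ∂μ, |y| ≤ 1)]

theorem norm_exp_I_mul_ofReal (t : ℝ) : ‖Complex.exp (Complex.I * (t : ℂ))‖ = 1 := by
  rw [mul_comm, Complex.norm_exp_ofReal_mul_I]

/-- The Fourier integral with parameter `-c` followed by the one with parameter `c` is, by Fubini,
the integral operator whose kernel is the Fourier transform of `μ` at `c (x - y)`. -/
theorem integral_exp_integral_exp {μ : Measure ℝ} [IsFiniteMeasure μ] (c x : ℝ) {g : ℝ → ℂ}
    (hg : Integrable g μ) :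
    ∫ z, Complex.exp (Complex.I * ((c * x * z : ℝ) : ℂ)) *
        ∫ y, Complex.exp (Complex.I * ((-c * z * y : ℝ) : ℂ)) * g y ∂μ ∂μ
      = ∫ y, (∫ z, Complex.exp (Complex.I * ((c * (x - y) * z : ℝ) : ℂ)) ∂μ) * g y ∂μ := by
  simp only [← integral_const_mul, ← integral_mul_const]
  rw [integral_integral_swap]
  · refine integral_congr_ae (ae_of_all _ fun y => integral_congr_ae (ae_of_all _ fun z => ?_))
    simp only
    rw [← mul_assoc, ← Complex.exp_add]
    congr 2
    push_cast; ring
  · have h1 : Integrable (fun q : ℝ × ℝ => g q.2) (μ.prod μ) := hg.comp_snd μ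
    have h2 : Integrable (fun q : ℝ × ℝ => Complex.exp (Complex.I * ((-c * q.1 * q.2 : ℝ) : ℂ))
        * g q.2) (μ.prod μ) :=
      h1.bdd_mul (c := 1) (by fun_prop) (ae_of_all _ fun q => (norm_exp_I_mul_ofReal _).le)
    exact h2.bdd_mul (c := 1) (by fun_prop) (ae_of_all _ fun q => (norm_exp_I_mul_ofReal _).le)

/-- The operator whose kernel is the Fourier transform of `μ` is `F(c) F(-c)`, that is
`(A + iB)(A - iB) = A² + B²`. -/
theorem coeFn_cosOp_sq_add_sinOp_sq (hodd : ∀ k, Odd k → ∫ y, y ^ k ∂μ = 0) (c : ℝ)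
    (g : Lp ℂ 2 μ) :
    (cosOp μ c (cosOp μ c g) + sinOp μ c (sinOp μ c g) : Lp ℂ 2 μ) =ᵐ[μ] fun x : ℝ =>
      ∫ y, (∫ z, Complex.exp (Complex.I * ((c * (x - y) * z : ℝ) : ℂ)) ∂μ) * g y ∂μ := by
  set f : Lp ℂ 2 μ := cosOp μ c g - Complex.I • sinOp μ c g with hf
  have h1 := coeFn_cosOp_add_sinOp (μ := μ) (-c) g
  rw [cosOp_neg, sinOp_neg, smul_neg, ← sub_eq_add_neg, ← hf] at h1
  have h2 := coeFn_cosOp_add_sinOp (μ := μ) c f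
  have h3 : cosOp μ c f + Complex.I • sinOp μ c f
      = cosOp μ c (cosOp μ c g) + sinOp μ c (sinOp μ c g) := by
    rw [hf, map_sub, map_sub, map_smul, map_smul, cosOp_sinOp hodd, sinOp_cosOp hodd, smul_zero,
      sub_zero, zero_sub, smul_neg, smul_smul, Complex.I_mul_I, neg_one_smul, neg_neg]
  rw [h3] at h2
  filter_upwards [h2] with x hx
  rw [hx, ← integral_exp_integral_exp c x (integrable_coeFn g)]
  refine integral_congr_ae ?_
  filter_upwards [h1] with z hz
  rw [hz]

end Composition

/-! ### The weight `(1 - y ^ 2) ^ α` -/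

section Weight

theorem weight_nonneg (α : ℝ) {y : ℝ} (hy : y ∈ Icc (-1 : ℝ) 1) : 0 ≤ weight α y :=
  Real.rpow_nonneg (by nlinarith [hy.1, hy.2]) _

theorem weight_le_one {α : ℝ} (hα : 0 ≤ α) {y : ℝ} (hy : y ∈ Icc (-1 : ℝ) 1) :
    weight α y ≤ 1 :=
  Real.rpow_le_one (by nlinarith [hy.1, hy.2]) (by nlinarith [sq_nonneg y]) hα

theorem weight_add {α β : ℝ} (hα : 0 ≤ α) (hβ : 0 ≤ β) {y : ℝ} (hy : y ∈ Icc (-1 : ℝ) 1) :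
    weight (α + β) y = weight α y * weight β y :=
  Real.rpow_add_of_nonneg (by nlinarith [hy.1, hy.2]) hα hβ

theorem measurable_weight (α : ℝ) : Measurable (weight α) :=
  (measurable_const.sub (measurable_id.pow_const 2)).pow_const α

theorem measurable_ofReal_weight (α : ℝ) : Measurable fun y => ENNReal.ofReal (weight α y) :=
  (measurable_weight α).ennreal_ofReal

theorem weightMeasure_absolutelyContinuous (α : ℝ) :
    weightMeasure α ≪ volume.restrict (Icc (-1) 1) :=
  withDensity_absolutelyContinuous _ _

theorem absolutelyContinuous_weightMeasure (α : ℝ) :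
    volume.restrict (Icc (-1) 1) ≪ weightMeasure α := by
  refine withDensity_absolutelyContinuous' (measurable_ofReal_weight α).aemeasurable ?_
  -- The density vanishes only at the endpoints.
  rw [← Measure.restrict_congr_set (Ioo_ae_eq_Icc (μ := volume)),
    ae_restrict_iff' measurableSet_Ioo]
  refine ae_of_all _ fun y hy => ?_
  rw [Ne, ENNReal.ofReal_eq_zero, not_le]
  exact Real.rpow_pos_of_pos (by nlinarith [hy.1, hy.2]) _

theorem weightMeasure_mono {α β : ℝ} (hβ : 0 ≤ β) (h : β ≤ α) :
    weightMeasure α ≤ weightMeasure β := by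
  refine withDensity_mono ?_
  refine (ae_restrict_iff' measurableSet_Icc).2 (ae_of_all _ fun y hy => ?_)
  refine ENNReal.ofReal_le_ofReal ?_
  have h1 : weight α y = weight β y * weight (α - β) y := by
    rw [← weight_add hβ (sub_nonneg.2 h) hy, add_sub_cancel]
  rw [h1]
  exact mul_le_of_le_one_right (weight_nonneg β hy) (weight_le_one (sub_nonneg.2 h) hy)

instance (α : ℝ) [hα : Fact (0 ≤ α)] : IsFiniteMeasure (weightMeasure α) := by
  have h0 : weightMeasure 0 = volume.restrict (Icc (-1) 1) := by
    simp [weightMeasure, weight, show (fun _ : ℝ => (1 : ENNReal)) = 1 from rfl]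
  exact isFiniteMeasure_of_le _ (h0 ▸ weightMeasure_mono le_rfl hα.out)

instance (α : ℝ) : Fact (∀ᵐ y ∂(weightMeasure α), |y| ≤ 1) :=
  ⟨(weightMeasure_absolutelyContinuous α).ae_le
    ((ae_restrict_mem measurableSet_Icc).mono fun _ hy => abs_le.2 hy)⟩

theorem frequently_of_ae_weightMeasure (α : ℝ) (p : ℝ → Prop)
    (hp : ∀ᵐ x ∂(weightMeasure α), p x) : ∃ᶠ x in 𝓝[≠] 0, p x := by
  have h1 : ∀ᵐ x ∂(volume.restrict (Icc (-1 : ℝ) 1)), p x :=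
    (absolutelyContinuous_weightMeasure α).ae_le hp
  intro hnot
  have h2 : ∀ᶠ x in 𝓝[>] (0 : ℝ), ¬ p x := hnot.filter_mono (nhdsGT_le_nhdsNE 0)
  obtain ⟨u, hu, hsub⟩ := mem_nhdsGT_iff_exists_Ioo_subset.1 h2
  have hu' : (0 : ℝ) < min u 1 := lt_min hu one_pos
  rw [ae_restrict_iff' measurableSet_Icc] at h1
  have h3 : volume (Ioo (0 : ℝ) (min u 1)) = 0 := by
    refine measure_mono_null (fun x hx => ?_) (ae_iff.1 h1)
    intro hx'
    exact hsub ⟨hx.1, hx.2.trans_le (min_le_left _ _)⟩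
      (hx' ⟨by linarith [hx.1], hx.2.le.trans (min_le_right _ _)⟩)
  rw [Real.volume_Ioo, sub_zero, ENNReal.ofReal_eq_zero] at h3
  linarith

theorem integral_weightMeasure {E : Type*} [NormedAddCommGroup E] [NormedSpace ℝ E] (α : ℝ)
    (f : ℝ → E) :
    ∫ y, f y ∂(weightMeasure α) = ∫ y in Icc (-1) 1, weight α y • f y := by
  rw [weightMeasure, integral_withDensity_eq_integral_toReal_smul (measurable_ofReal_weight α)
    (ae_of_all _ fun _ => ENNReal.ofReal_lt_top)]
  refine setIntegral_congr_fun measurableSet_Icc fun y hy => ?_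
  simp only [ENNReal.toReal_ofReal (weight_nonneg α hy)]

theorem integral_odd_pow_weightMeasure (α : ℝ) (k : ℕ) (hk : Odd k) :
    ∫ y, y ^ k ∂(weightMeasure α) = 0 := by
  rw [integral_weightMeasure, integral_Icc_eq_integral_Ioc,
    ← intervalIntegral.integral_of_le (by norm_num)]
  have h := intervalIntegral.integral_comp_neg (a := -1) (b := 1)
    fun y : ℝ => weight α y • y ^ k
  simp only [neg_neg, weight, neg_sq, hk.neg_pow, smul_eq_mul, mul_neg,
    intervalIntegral.integral_neg] at h
  simp only [weight, smul_eq_mul]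
  linarith

end Weight

/-! ### Poisson's integral for the Bessel function -/

section Poisson

theorem integral_rpow_mul_one_sub_rpow {u v : ℝ} (hu : 0 < u) (hv : 0 < v) :
    ∫ x in Ioc (0 : ℝ) 1, x ^ (u - 1) * (1 - x) ^ (v - 1)
      = Real.Gamma u * Real.Gamma v / Real.Gamma (u + v) := by
  have h := Complex.betaIntegral_eq_Gamma_mul_div u v (by simpa) (by simpa)
  rw [Complex.betaIntegral, intervalIntegral.integral_of_le zero_le_one, ← Complex.ofReal_add,
    Complex.Gamma_ofReal, Complex.Gamma_ofReal, Complex.Gamma_ofReal] at h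
  rw [← Complex.ofReal_inj, ← integral_complex_ofReal]
  push_cast
  rw [← h]
  refine setIntegral_congr_fun measurableSet_Ioc fun x hx => ?_
  rw [Complex.ofReal_cpow hx.1.le, Complex.ofReal_cpow (by linarith [hx.2])]
  push_cast; rfl

/-- The even moments of the weight, by the substitution `u = y ^ 2` in Euler's beta integral. -/
theorem integral_even_pow_weightMeasure {α : ℝ} (hα : 0 ≤ α) (k : ℕ) :
    ∫ y, y ^ (2 * k) ∂(weightMeasure α)
      = Real.Gamma (k + 1 / 2) * Real.Gamma (α + 1) / Real.Gamma (k + (α + 1 / 2) + 1) := by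
  let f : ℝ → ℝ := (Iic 1).indicator fun x => weight α x * x ^ (2 * k)
  let g : ℝ → ℝ := (Iic 1).indicator fun u => u ^ ((k : ℝ) + 1 / 2 - 1) * (1 - u) ^ (α + 1 - 1)
  have h1 : ∫ y, y ^ (2 * k) ∂(weightMeasure α) = ∫ y, f |y| := by
    rw [integral_weightMeasure, ← integral_indicator measurableSet_Icc]
    refine integral_congr_ae (ae_of_all _ fun y => ?_)
    simp only [f, indicator_apply, mem_Icc, ← abs_le, mem_Iic, weight, sq_abs,
      (even_two_mul k).pow_abs, smul_eq_mul]
  have h2 : ∫ x in Ioi (0 : ℝ), (2 * x ^ ((2 : ℝ) - 1)) • g (x ^ (2 : ℝ))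
      = ∫ x in Ioi (0 : ℝ), 2 * f x := by
    refine setIntegral_congr_fun measurableSet_Ioi fun x (hx : 0 < x) => ?_
    have hiff : x ^ 2 ≤ 1 ↔ x ≤ 1 := by
      rw [← abs_of_pos hx, sq_abs, sq_le_one_iff_abs_le_one]
    simp only [Real.rpow_two, f, g, indicator_apply, mem_Iic, hiff]
    split_ifs with h
    · have hpow : x ^ (2 * k) = x * (x ^ 2) ^ ((k : ℝ) + 1 / 2 - 1) := by
        rw [← Real.rpow_two, ← Real.rpow_mul hx.le]
        nth_rewrite 2 [← Real.rpow_one x]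
        rw [← Real.rpow_add hx, ← Real.rpow_natCast]
        congr 1; push_cast; ring
      rw [hpow, weight, add_sub_cancel_right, smul_eq_mul, show (2 : ℝ) - 1 = 1 by norm_num,
        Real.rpow_one]
      ring
    · simp
  have h3 : ∫ u in Ioi (0 : ℝ), g u
      = ∫ u in Ioc (0 : ℝ) 1, u ^ ((k : ℝ) + 1 / 2 - 1) * (1 - u) ^ (α + 1 - 1) := by
    rw [setIntegral_indicator measurableSet_Iic, Ioi_inter_Iic]
  rw [h1, integral_comp_abs, ← integral_const_mul, ← h2,
    integral_comp_rpow_Ioi_of_pos two_pos, h3,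
    integral_rpow_mul_one_sub_rpow (by positivity) (by positivity)]
  congr 2; ring

/-- The value of `Γ (k + 1/2)`, in a form free of division. -/
theorem Gamma_nat_add_half_mul (k : ℕ) :
    Real.Gamma (k + 1 / 2) * (4 ^ k * k.factorial) = (2 * k).factorial * √Real.pi := by
  induction k with
  | zero => simp [Real.Gamma_one_half_eq, -one_div]
  | succ k ih =>
    rw [show ((k + 1 : ℕ) : ℝ) + 1 / 2 = (k + 1 / 2) + 1 by push_cast; ring,
      Real.Gamma_add_one (by positivity), show 2 * (k + 1) = 2 * k + 1 + 1 by ring,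
      Nat.factorial_succ, Nat.factorial_succ, Nat.factorial_succ]
    push_cast
    linear_combination (2 * (k : ℝ) + 1) * (2 * k + 2) * ih

/-- Poisson's integral: `kernel α` is the Fourier transform of the weight `ω_α`. -/
theorem integral_exp_weightMeasure {α : ℝ} (hα : 0 ≤ α) (t : ℝ) :
    ∫ z, Complex.exp (Complex.I * ((t * z : ℝ) : ℂ)) ∂(weightMeasure α) = (kernel α t : ℂ) := by
  have := Fact.mk hα
  have h := hasSum_integral_exp (μ := weightMeasure α) t 1 (integrable_const (1 : ℂ))
  simp only [mul_one, Complex.ofReal_one, one_pow] at h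
  have hmom : ∀ k : ℕ, ∫ y : ℝ, (y : ℂ) ^ k ∂(weightMeasure α)
      = ((∫ y, y ^ k ∂(weightMeasure α) : ℝ) : ℂ) := fun k => by
    rw [← integral_complex_ofReal]; push_cast; rfl
  simp only [hmom] at h
  have hinj : Function.Injective fun k : ℕ => 2 * k := fun a b hab => by simpa using hab
  -- Only the even moments contribute.
  rw [← hinj.hasSum_iff fun k hk => by
    have hodd : Odd k := by
      rw [← Nat.not_even_iff_odd]
      rintro ⟨m, rfl⟩
      exact hk ⟨m, two_mul m⟩
    rw [integral_odd_pow_weightMeasure α k hodd, Complex.ofReal_zero, mul_zero]] at h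
  rw [← h.tsum_eq, kernel, besselRatio, ← tsum_mul_left, Complex.ofReal_tsum]
  refine tsum_congr fun k => ?_
  have hexp : expCoeff t (2 * k)
      = (((-1) ^ k * t ^ (2 * k) / ((2 * k).factorial : ℝ) : ℝ) : ℂ) := by
    rw [expCoeff, mul_pow, pow_mul Complex.I, Complex.I_sq]; push_cast; rfl
  simp only [Function.comp]
  rw [hexp, ← Complex.ofReal_mul, integral_even_pow_weightMeasure hα]
  congr 1
  have hG := Gamma_nat_add_half_mul k
  have hg : Real.Gamma (k + (α + 1 / 2) + 1) ≠ 0 := (Real.Gamma_pos_of_pos (by positivity)).ne'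
  have hpow : (2 : ℝ) ^ (α + 1 / 2) * 2 ^ (-(2 * (k : ℝ) + (α + 1 / 2))) = (4 ^ k)⁻¹ := by
    rw [← Real.rpow_add two_pos, show α + 1 / 2 + -(2 * (k : ℝ) + (α + 1 / 2)) = -(2 * (k : ℝ)) by
      ring, Real.rpow_neg two_pos.le, Real.rpow_mul two_pos.le, Real.rpow_natCast]
    norm_num
  have hG' : Real.Gamma (k + 1 / 2)
      = (2 * k).factorial * √Real.pi / (4 ^ k * k.factorial) := by
    rw [← hG]; field_simp
  rw [hG']
  calc _ = √Real.pi * (4 ^ k)⁻¹ * Real.Gamma (α + 1) * ((-1) ^ k /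
        (k.factorial * Real.Gamma (k + (α + 1 / 2) + 1)) * t ^ (2 * k)) := by field_simp
    _ = _ := by rw [← hpow]; ring

end Poisson

/-! ### The operators of the weighted space and their eigenvalues -/

section Operators

variable {α : ℝ}

theorem kernelOp_eq (hα : 0 ≤ α) (c : ℝ) (g : ℝ → ℂ) (x : ℝ) :
    kernelOp α c g x = ((c / (2 * Real.pi) : ℝ) : ℂ) *
      ∫ y, (∫ z, Complex.exp (Complex.I * ((c * (x - y) * z : ℝ) : ℂ)) ∂(weightMeasure α)) * g y
        ∂(weightMeasure α) := by
  rw [kernelOp, ← integral_const_mul]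
  simp only [integral_exp_weightMeasure hα]
  refine integral_congr_ae (ae_of_all _ fun y => ?_)
  simp only
  push_cast; ring

/-- The pointwise a.e. eigenvalue equation, as an equation in `L²(ω_α)`. -/
theorem eigenEq_iff {T : (ℝ → ℂ) → ℝ → ℂ} {s : ℂ} {g Tg : WeightedL2 α}
    (h : Tg =ᵐ[weightMeasure α] T g) : EigenEq T s g ↔ Tg = s • g := by
  rw [EigenEq, Lp.ext_iff]
  constructor
  · intro hT
    filter_upwards [h, hT, Lp.coeFn_smul s g] with x h1 h2 h3
    rw [h1, h2, h3]; rfl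
  · intro hT
    filter_upwards [h, hT, Lp.coeFn_smul s g] with x h1 h2 h3
    rw [← h1, h2, h3]; rfl

/-- The bounded operator on `L²(ω_α)` given by `fourierOp`. -/
def fourierCLM (α : ℝ) [Fact (0 ≤ α)] (c : ℝ) : WeightedL2 α →L[ℂ] WeightedL2 α :=
  cosOp (weightMeasure α) c + Complex.I • sinOp (weightMeasure α) c

theorem coeFn_fourierCLM [Fact (0 ≤ α)] (c : ℝ) (g : WeightedL2 α) :
    fourierCLM α c g =ᵐ[weightMeasure α] fourierOp α c g :=
  coeFn_cosOp_add_sinOp c g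

theorem fourierCLM_apply_eigenvector [Fact (0 ≤ α)] {c a b : ℝ} {f : WeightedL2 α}
    (ha : cosOp (weightMeasure α) c f = (a : ℂ) • f)
    (hb : sinOp (weightMeasure α) c f = (b : ℂ) • f) :
    fourierCLM α c f = (a + Complex.I * b : ℂ) • f := by
  rw [fourierCLM, add_apply, smul_apply, ha, hb, smul_smul, add_smul]

/-- The bounded operator on `L²(ω_α)` given by `kernelOp`. -/
def kernelCLM (α : ℝ) [Fact (0 ≤ α)] (c : ℝ) : WeightedL2 α →L[ℂ] WeightedL2 α :=
  ((c / (2 * Real.pi) : ℝ) : ℂ) •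
    (cosOp (weightMeasure α) c ∘L cosOp (weightMeasure α) c +
      sinOp (weightMeasure α) c ∘L sinOp (weightMeasure α) c)

theorem eigenEq_kernelOp_iff [hα : Fact (0 ≤ α)] {c : ℝ} {s : ℂ} {g : WeightedL2 α} :
    EigenEq (kernelOp α c) s g ↔ kernelCLM α c g = s • g := by
  refine eigenEq_iff ?_
  filter_upwards [coeFn_cosOp_sq_add_sinOp_sq (integral_odd_pow_weightMeasure α) c g,
    Lp.coeFn_smul ((c / (2 * Real.pi) : ℝ) : ℂ) (cosOp (weightMeasure α) c
      (cosOp (weightMeasure α) c g) + sinOp (weightMeasure α) c (sinOp (weightMeasure α) c g))]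
    with x h1 h2
  rw [kernelOp_eq hα.out, ← h1]
  exact h2

theorem isSymmetric_kernelCLM [Fact (0 ≤ α)] (c : ℝ) : (kernelCLM α c).IsSymmetric := by
  intro f g
  have hA : (cosOp (weightMeasure α) c).IsSymmetric := isSymmetric_powerOp
  have hB : (sinOp (weightMeasure α) c).IsSymmetric := isSymmetric_powerOp
  have hA' : ∀ f g, ⟪cosOp (weightMeasure α) c f, g⟫_ℂ = ⟪f, cosOp (weightMeasure α) c g⟫_ℂ := hA
  have hB' : ∀ f g, ⟪sinOp (weightMeasure α) c f, g⟫_ℂ = ⟪f, sinOp (weightMeasure α) c g⟫_ℂ := hB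
  simp [kernelCLM, inner_add_left, inner_add_right, inner_smul_left, inner_smul_right, map_ofNat,
    hA', hB']

theorem exists_eigenbasis [Fact (0 ≤ α)] {c : ℝ} (hc : 0 < c) :
    ∃ (ψ : HilbertBasis ℕ ℂ (WeightedL2 α)) (a b : ℕ → ℝ),
      (∀ n, cosOp (weightMeasure α) c (ψ n) = (a n : ℂ) • ψ n) ∧
      (∀ n, sinOp (weightMeasure α) c (ψ n) = (b n : ℂ) • ψ n) ∧
      Antitone fun n => a n ^ 2 + b n ^ 2 :=
  exists_antitone_joint_hilbertBasis
    (not_finiteDimensional_Lp (frequently_of_ae_weightMeasure α))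
    (isCompactOperator_powerOp (summable_norm_re_expCoeff c))
    (isCompactOperator_powerOp (summable_norm_im_expCoeff c))
    isSymmetric_powerOp isSymmetric_powerOp
    (cosOp_sinOp (integral_odd_pow_weightMeasure α) c)
    (eq_zero_of_cosOp_eq_zero_of_sinOp_eq_zero (frequently_of_ae_weightMeasure α) hc.ne')

theorem kernelCLM_apply_eigenvector [Fact (0 ≤ α)] {c a b : ℝ} {f : WeightedL2 α}
    (ha : cosOp (weightMeasure α) c f = (a : ℂ) • f)
    (hb : sinOp (weightMeasure α) c f = (b : ℂ) • f) :
    kernelCLM α c f = ((c / (2 * Real.pi) * (a ^ 2 + b ^ 2) : ℝ) : ℂ) • f := by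
  simp only [kernelCLM, smul_apply, add_apply, ContinuousLinearMap.comp_apply, ha, hb, map_smul,
    smul_smul, ← add_smul]
  congr 1
  push_cast; ring

/-- The eigenvalue `lam α c n` read off from a sorted joint eigenbasis. -/
theorem lam_eq [Fact (0 ≤ α)] {c : ℝ} (hc : 0 < c) {ψ : HilbertBasis ℕ ℂ (WeightedL2 α)}
    {a b : ℕ → ℝ} (ha : ∀ n, cosOp (weightMeasure α) c (ψ n) = (a n : ℂ) • ψ n)
    (hb : ∀ n, sinOp (weightMeasure α) c (ψ n) = (b n : ℂ) • ψ n)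
    (hab : Antitone fun n => a n ^ 2 + b n ^ 2) (n : ℕ) :
    lam α c n = c / (2 * Real.pi) * (a n ^ 2 + b n ^ 2) := by
  have h := setOf_linearIndependent_eigenvectors_eq_Iic ψ (isSymmetric_kernelCLM c)
    (l := fun n => c / (2 * Real.pi) * (a n ^ 2 + b n ^ 2))
    (fun m n hmn => mul_le_mul_of_nonneg_left (hab hmn) (by positivity))
    (fun n => kernelCLM_apply_eigenvector (ha n) (hb n)) n
  simp only [lam, eigenEq_kernelOp_iff]
  rw [h, csSup_Iic]

end Operators

/-! ### Monotonicity in the weight exponent -/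

section Comparison

variable {α β : ℝ}

theorem lintegral_weightMeasure {f : ℝ → ENNReal} (hf : AEMeasurable f (weightMeasure α)) :
    ∫⁻ y, f y ∂(weightMeasure α)
      = ∫⁻ y in Icc (-1) 1, ENNReal.ofReal (weight α y) * f y :=
  lintegral_withDensity_eq_lintegral_mul₀' (μ := volume.restrict (Icc (-1) 1))
    (measurable_ofReal_weight α).aemeasurable hf

/-- Holds because `ω_β * ω_{α-β} ^ 2 ≤ ω_β * ω_{α-β} = ω_α`. -/
theorem eLpNorm_weight_mul_le (hβ : 0 ≤ β) (h : β ≤ α) {g : ℝ → ℂ}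
    (hg : AEStronglyMeasurable g (weightMeasure α)) :
    eLpNorm (fun y => (weight (α - β) y : ℂ) * g y) 2 (weightMeasure β)
      ≤ eLpNorm g 2 (weightMeasure α) := by
  have hg' : AEStronglyMeasurable g (volume.restrict (Icc (-1) 1)) :=
    hg.mono_ac (absolutelyContinuous_weightMeasure α)
  have hw : AEStronglyMeasurable (fun y => (weight (α - β) y : ℂ) * g y)
      (volume.restrict (Icc (-1) 1)) :=
    (Complex.measurable_ofReal.comp (measurable_weight _)).aestronglyMeasurable.mul hg'
  rw [eLpNorm_eq_lintegral_rpow_enorm_toReal two_ne_zero ENNReal.ofNat_ne_top,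
    eLpNorm_eq_lintegral_rpow_enorm_toReal two_ne_zero ENNReal.ofNat_ne_top]
  gcongr ?_ ^ _
  have hm : AEMeasurable (fun y => ‖(weight (α - β) y : ℂ) * g y‖ₑ ^ ENNReal.toReal 2)
      (weightMeasure β) :=
    (hw.enorm.pow_const _).mono_ac (weightMeasure_absolutelyContinuous β)
  rw [lintegral_weightMeasure hm, lintegral_weightMeasure (hg.enorm.pow_const _)]
  refine setLIntegral_mono_ae' measurableSet_Icc (ae_of_all _ fun y hy => ?_)
  have hw0 := weight_nonneg (α - β) hy
  have hw1 := weight_le_one (sub_nonneg.2 h) hy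
  have h1 : weight α y = weight β y * weight (α - β) y := by
    rw [← weight_add hβ (sub_nonneg.2 h) hy, add_sub_cancel]
  simp only [ENNReal.toReal_ofNat, ENNReal.rpow_ofNat, enorm_mul, mul_pow]
  rw [h1, ENNReal.ofReal_mul (weight_nonneg β hy), mul_assoc]
  gcongr
  have h2 : ‖(weight (α - β) y : ℂ)‖ₑ = ENNReal.ofReal (weight (α - β) y) := by
    rw [← ofReal_norm, Complex.norm_real, Real.norm_of_nonneg hw0]
  rw [h2, sq]
  exact mul_le_of_le_one_right' (ENNReal.ofReal_le_one.2 hw1)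

theorem memLp_weight_mul (hβ : 0 ≤ β) (h : β ≤ α) (g : WeightedL2 α) :
    MemLp (fun y => (weight (α - β) y : ℂ) * g y) 2 (weightMeasure β) := by
  refine ⟨?_, (eLpNorm_weight_mul_le hβ h (Lp.aestronglyMeasurable g)).trans_lt
    (Lp.eLpNorm_lt_top g)⟩
  exact ((Complex.measurable_ofReal.comp (measurable_weight _)).aestronglyMeasurable.mul
    ((Lp.aestronglyMeasurable g).mono_ac (absolutelyContinuous_weightMeasure α))).mono_ac
    (weightMeasure_absolutelyContinuous β)

/-- Multiplication by `ω_{α - β}`, as a linear map from `L²(ω_α)` to `L²(ω_β)`, for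
`0 ≤ β ≤ α`. -/
def mulWeight (hβ : 0 ≤ β) (h : β ≤ α) : WeightedL2 α →ₗ[ℂ] WeightedL2 β where
  toFun g := (memLp_weight_mul hβ h g).toLp _
  map_add' f g := by
    rw [← MemLp.toLp_add, MemLp.toLp_eq_toLp_iff]
    filter_upwards [(weightMeasure_absolutelyContinuous β).trans
      (absolutelyContinuous_weightMeasure α) |>.ae_le (Lp.coeFn_add f g)] with y hy
    simp only [hy, Pi.add_apply, mul_add]
  map_smul' s g := by
    rw [RingHom.id_apply, ← MemLp.toLp_const_smul, MemLp.toLp_eq_toLp_iff]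
    filter_upwards [(weightMeasure_absolutelyContinuous β).trans
      (absolutelyContinuous_weightMeasure α) |>.ae_le (Lp.coeFn_smul s g)] with y hy
    simp only [hy, Pi.smul_apply, smul_eq_mul, mul_left_comm]

theorem coeFn_mulWeight (hβ : 0 ≤ β) (h : β ≤ α) (g : WeightedL2 α) :
    mulWeight hβ h g =ᵐ[weightMeasure β] fun y => (weight (α - β) y : ℂ) * g y :=
  (memLp_weight_mul hβ h g).coeFn_toLp

theorem norm_mulWeight_le (hβ : 0 ≤ β) (h : β ≤ α) (g : WeightedL2 α) :
    ‖mulWeight hβ h g‖ ≤ ‖g‖ := by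
  rw [Lp.norm_def, Lp.norm_def, eLpNorm_congr_ae (coeFn_mulWeight hβ h g)]
  exact ENNReal.toReal_mono (Lp.eLpNorm_ne_top g)
    (eLpNorm_weight_mul_le hβ h (Lp.aestronglyMeasurable g))

theorem fourierOp_mulWeight (hβ : 0 ≤ β) (h : β ≤ α) (c : ℝ) (g : WeightedL2 α) (x : ℝ) :
    fourierOp β c (mulWeight hβ h g) x = fourierOp α c g x := by
  have h1 : fourierOp β c (mulWeight hβ h g) x
      = fourierOp β c (fun y => (weight (α - β) y : ℂ) * g y) x := by
    refine integral_congr_ae ?_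
    filter_upwards [coeFn_mulWeight hβ h g] with y hy
    rw [hy]
  rw [h1, fourierOp, fourierOp, integral_weightMeasure, integral_weightMeasure]
  refine setIntegral_congr_fun measurableSet_Icc fun y hy => ?_
  have h2 : weight α y = weight β y * weight (α - β) y := by
    rw [← weight_add hβ (sub_nonneg.2 h) hy, add_sub_cancel]
  simp only [h2, Complex.real_smul]
  push_cast; ring

/-- The two transforms produce the same function, and the norm of `L²(ω_β)` dominates that of
`L²(ω_α)`. -/
theorem norm_fourierCLM_le [Fact (0 ≤ α)] [hβ : Fact (0 ≤ β)] (h : β ≤ α) (c : ℝ)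
    (g : WeightedL2 α) :
    ‖fourierCLM α c g‖ ≤ ‖fourierCLM β c (mulWeight hβ.out h g)‖ := by
  have h1 : fourierOp β c (mulWeight hβ.out h g) = fourierOp α c g :=
    funext fun x => fourierOp_mulWeight hβ.out h c g x
  have h2 := coeFn_fourierCLM (α := β) c (mulWeight hβ.out h g)
  rw [h1] at h2
  rw [Lp.norm_def, Lp.norm_def]
  refine ENNReal.toReal_mono (Lp.eLpNorm_ne_top _) ?_
  rw [eLpNorm_congr_ae h2, eLpNorm_congr_ae (coeFn_fourierCLM c g)]
  exact eLpNorm_mono_measure _ (weightMeasure_mono hβ.out h)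

theorem norm_add_I_mul_sq (a b : ℝ) : ‖(a + Complex.I * b : ℂ)‖ ^ 2 = a ^ 2 + b ^ 2 := by
  rw [mul_comm, Complex.sq_norm, Complex.normSq_add_mul_I]

theorem lam_le_lam (hβ : 0 ≤ β) (h : β ≤ α) {c : ℝ} (hc : 0 < c) (n : ℕ) :
    lam α c n ≤ lam β c n := by
  have := Fact.mk hβ
  have := Fact.mk (hβ.trans h)
  obtain ⟨ψ, a, b, ha, hb, hab⟩ := exists_eigenbasis (α := α) hc
  obtain ⟨ψ', a', b', ha', hb', hab'⟩ := exists_eigenbasis (α := β) hc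
  have hanti : ∀ {a b : ℕ → ℝ}, (Antitone fun n => a n ^ 2 + b n ^ 2) →
      Antitone fun n => ‖(a n + Complex.I * b n : ℂ)‖ := fun hab m n hmn => by
    rw [← pow_le_pow_iff_left₀ (norm_nonneg _) (norm_nonneg _) two_ne_zero, norm_add_I_mul_sq,
      norm_add_I_mul_sq]
    exact hab hmn
  have key := norm_eigenvalue_le_of_contraction ψ ψ'
    (fun n => fourierCLM_apply_eigenvector (ha n) (hb n))
    (fun n => fourierCLM_apply_eigenvector (ha' n) (hb' n)) (hanti hab) (hanti hab')
    (mulWeight hβ h) (norm_mulWeight_le hβ h) (norm_fourierCLM_le h c) n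
  rw [lam_eq hc ha hb hab, lam_eq hc ha' hb' hab', ← norm_add_I_mul_sq, ← norm_add_I_mul_sq]
  gcongr

end Comparison

end GPSWF

end

theorem mainTheorem1 (c : ℝ) (hc : 0 < c) :
    (∀ α : ℝ, 0 ≤ α →
      Antitone (GPSWF.lam α c) ∧
      ∃ (ψ : HilbertBasis ℕ ℂ (GPSWF.WeightedL2 α)) (μ : ℕ → ℂ), ∀ n : ℕ,
        GPSWF.EigenEq (GPSWF.fourierOp α c) (μ n) (ψ n) ∧
        GPSWF.EigenEq (GPSWF.kernelOp α c) (GPSWF.lam α c n : ℂ) (ψ n) ∧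
        GPSWF.lam α c n = c / (2 * Real.pi) * ‖μ n‖ ^ 2) ∧
    (∀ (n : ℕ) (α α' : ℝ), 0 ≤ α' → α' ≤ α → GPSWF.lam α c n ≤ GPSWF.lam α' c n) := by
  refine ⟨fun α hα => ?_, fun n α α' hα' h => GPSWF.lam_le_lam hα' h hc n⟩
  have := Fact.mk hα
  obtain ⟨ψ, a, b, ha, hb, hab⟩ := GPSWF.exists_eigenbasis (α := α) hc
  have hlam := GPSWF.lam_eq hc ha hb hab
  refine ⟨fun m n hmn => ?_, ψ, fun n => a n + Complex.I * b n, fun n => ⟨?_, ?_, ?_⟩⟩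
  · rw [hlam, hlam]
    exact mul_le_mul_of_nonneg_left (hab hmn) (by positivity)
  · exact (GPSWF.eigenEq_iff (GPSWF.coeFn_fourierCLM c (ψ n))).2
      (GPSWF.fourierCLM_apply_eigenvector (ha n) (hb n))
  · rw [hlam]
    exact GPSWF.eigenEq_kernelOp_iff.2 (GPSWF.kernelCLM_apply_eigenvector (ha n) (hb n))
  · rw [hlam, GPSWF.norm_add_I_mul_sq]
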